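/- \textbf{Setting.} Let $M$ parametric model classes be given. For each sample size $n$ the observable $X_n$ takes values in a measurable space $\mathcal X_n$ with a dominating measure $\nu_n$; class $m\in\{1,\dots,M\}$ consists of the distributions $F_{mn}(\theta_m)$ with densities $f_{mn}(\cdot;\theta_m)$ with respect to $\nu_n$, $\theta_m\in\Theta_m$, where $\Theta_m\subseteq\mathbb R^{g_m}$ is open and $g_m\ge 1$. Fix classes $m$ (assumed) and $m'$ (true) and a true parameter $\theta_{m'}\in\Theta_{m'}$, so that $X_n\sim F_{m'n}(\theta_{m'})$; all probabilities, expectations and covariances below are taken under these distributions. Write $$U_{mn}(\theta_m;x)=\nabla_{\theta_m}\log f_{mn}(x;\theta_m),\qquad A_{mn}(\theta_m;x)=-\nabla_{\theta_m\theta_m^{t}}\log f_{mn}(x;\theta_m),$$ $$K^{(n)}_{m,m'}(\theta_m,\theta_{m'})=\int\log\left\{\frac{f_{mn}(x;\theta_m)}{f_{m'n}(x;\theta_{m'})}\right\}f_{m'n}(x;\theta_{m'})\,\nu_n(dx).$$ \textbf{Assumptions.} \begin{enumerate} \item For every $n$, for almost every observation $x$, $f_{mn}(x;\cdot)>0$ and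 $\log f_{mn}(x;\cdot)$ is twice continuously differentiable on $\Theta_m$. \item The integral $K^{(n)}_{m,m'}(\theta_m,\theta_{m'})$ converges absolutely for all $n$ and $\theta_m\in\Theta_m$, and $\frac1n K^{(n)}_{m,m'}(\theta_m,\theta_{m'})\to K_{m,m'}(\theta_m,\theta_{m'})\in\mathbb R$ for every $\theta_m\in\Theta_m$. \item $\theta^{*(n)}_{m,m'}\in\Theta_m$ maximizes $K^{(n)}_{m,m'}(\cdot,\theta_{m'})$ over $\Theta_m$, $\theta^{*}_{m,m'}\in\Theta_m$ maximizes $K_{m,m'}(\cdot,\theta_{m'})$ over $\Theta_m$, and $\theta^{*(n)}_{m,m'}\to\theta^*_{m,m'}$. \item On some neighbourhood of $\theta^*_{m,m'}$, uniformly in $\theta_m$, $\frac1nU_{mn}(\theta_m;X_n)\to U_{m,m'}(\theta_m,\theta_{m'})$ and $\frac1nA_{mn}(\theta_m;X_n)\to A_{m,m'}(\theta_m,\theta_{m'})$ in probability, for some limit functions $U_{m,m'}$, $A_{m,m'}$; the matrix $A:=A_{m,m'}(\theta^*_{m,m'},\theta_{m'})$ is invertible. \item $U_{mn}(\theta^{*(n)}_{m,m'};X_n)$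 is square integrable for every $n$, $\frac1n\mathrm{Cov}\{U_{mn}(\theta^{*(n)}_{m,m'};X_n)\}\to\Sigma$, and $\frac1{\sqrt n}U_{mn}(\theta^{*(n)}_{m,m'};X_n)\xrightarrow{d}N(0,\Sigma)$. \item $\hat\theta_{mn}=\hat\theta_{mn}(X_n)$ are estimators such that, with probability tending to one, $\hat\theta_{mn}\in\Theta_m$ and $\hat\theta_{mn}$ maximizes the likelihood $\theta_m\mapsto f_{mn}(X_n;\theta_m)$ over $\Theta_m$; and $\hat\theta_{mn}\to\theta^*_{m,m'}$ in probability. \end{enumerate} \textbf{Conclusion.} The matrix $A^{-1}\Sigma A^{-1}$ is positive semidefinite and, as $n\to\infty$, under the true class $m'$ with parameter $\theta_{m'}$, $$\sqrt n\left(\hat\theta_{mn}-\theta^{*(n)}_{m,m'}\right)\xrightarrow{d}N\left(0,A^{-1}\Sigma A^{-1}\right).$$ -/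

import Mathlib

open MeasureTheory ProbabilityTheory Filter Topology

/-- `M` parametric model classes for a sequence of observables `X n` with values in sample spaces
`𝒳 n`: class `m` consists of the distributions with density `f m n θ` with respect to the dominating
measure `ν n`, where `θ` runs through the open set `Θ m` of a Euclidean space of dimension `g m`. -/
structure ModelClasses (M : ℕ) where
  g : Fin M → ℕ
  g_pos : ∀ m, 0 < g m
  Θ : (m : Fin M) → Set (EuclideanSpace ℝ (Fin (g m)))
  isOpen_Θ : ∀ m, IsOpen (Θ m)
  𝒳 : ℕ → Type*
  [measurableSpace : ∀ n, MeasurableSpace (𝒳 n)]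
  ν : (n : ℕ) → Measure (𝒳 n)
  f : (m : Fin M) → (n : ℕ) → EuclideanSpace ℝ (Fin (g m)) → 𝒳 n → ℝ
  measurable_f : ∀ m n, ∀ θ ∈ Θ m, Measurable (f m n θ)
  f_nonneg : ∀ m n, ∀ θ ∈ Θ m, ∀ x, 0 ≤ f m n θ x
  lintegral_f : ∀ m n, ∀ θ ∈ Θ m, ∫⁻ x, ENNReal.ofReal (f m n θ x) ∂(ν n) = 1

namespace ModelClasses

attribute [instance] ModelClasses.measurableSpace

noncomputable section

variable {M : ℕ} (S : ModelClasses M)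

/-- The Euclidean space that contains the parameters of class `m`. -/
abbrev Param (m : Fin M) : Type := EuclideanSpace ℝ (Fin (S.g m))

/-- The distribution of the observable `X n` under class `m` with parameter `θ`. -/
def law (m : Fin M) (n : ℕ) (θ : S.Θ m) : Measure (S.𝒳 n) :=
  (S.ν n).withDensity fun x => ENNReal.ofReal (S.f m n θ x)

instance (m : Fin M) (n : ℕ) (θ : S.Θ m) : IsProbabilityMeasure (S.law m n θ) :=
  ⟨by rw [law, withDensity_apply _ MeasurableSet.univ, Measure.restrict_univ,
    S.lintegral_f m n θ θ.2]⟩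

/-- The log-likelihood of class `m` at the observation `x`. -/
def logLik (m : Fin M) (n : ℕ) (x : S.𝒳 n) (θ : S.Param m) : ℝ :=
  Real.log (S.f m n θ x)

/-- The score function: the gradient of the log-likelihood in the parameter. -/
def score (m : Fin M) (n : ℕ) (θ : S.Param m) (x : S.𝒳 n) : S.Param m :=
  gradient (S.logLik m n x) θ

/-- The observed information matrix: minus the Hessian of the log-likelihood, that is, minus the
Jacobian of the score. -/
def obsInfo (m : Fin M) (n : ℕ) (θ : S.Param m) (x : S.𝒳 n) :
    Matrix (Fin (S.g m)) (Fin (S.g m)) ℝ :=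
  Matrix.of fun i j =>
    -(fderiv ℝ (fun η => S.score m n η x) θ (EuclideanSpace.single j 1)) i

/-- The integrand of the (negative) Kullback-Leibler divergence `KL`. -/
def klIntegrand (m m' : Fin M) (n : ℕ) (θ : S.Param m) (θ' : S.Param m') (x : S.𝒳 n) : ℝ :=
  Real.log (S.f m n θ x / S.f m' n θ' x) * S.f m' n θ' x

/-- The quantity `∫ log (f m n θ / f m' n θ') f m' n θ' dν`, which is `≤ 0`. -/
def KL (m m' : Fin M) (n : ℕ) (θ : S.Param m) (θ' : S.Param m') : ℝ :=
  ∫ x, S.klIntegrand m m' n θ θ' x ∂(S.ν n)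

/-- The covariance matrix, under class `m'` with parameter `θ'`, of the score of class `m` at `θ`. -/
def scoreCov (m m' : Fin M) (n : ℕ) (θ : S.Param m) (θ' : S.Θ m') :
    Matrix (Fin (S.g m)) (Fin (S.g m)) ℝ :=
  Matrix.of fun i j =>
    covariance (fun x => S.score m n θ x i) (fun x => S.score m n θ x j) (S.law m' n θ')

/-- `θ` is a maximum likelihood estimate in class `m` for the observation `x`. -/
def IsMLE (m : Fin M) (n : ℕ) (x : S.𝒳 n) (θ : S.Param m) : Prop :=
  θ ∈ S.Θ m ∧ IsMaxOn (fun η => S.f m n η x) (S.Θ m) θ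

end

end ModelClasses

/-- Convergence in probability of `Z n`, defined on the probability space `(Ω n, P n)`, to the
constant `z`. -/
def TendstoInProb {Ω : ℕ → Type*} [∀ n, MeasurableSpace (Ω n)] (P : (n : ℕ) → Measure (Ω n))
    {E : Type*} [PseudoMetricSpace E] (Z : (n : ℕ) → Ω n → E) (z : E) : Prop :=
  ∀ ε : ℝ, 0 < ε → Tendsto (fun n => P n {x | ε ≤ dist (Z n x) z}) atTop (𝓝 0)

/-- Convergence in probability of `G n θ` to `h θ`, uniformly in `θ ∈ N`. -/
def TendstoInProbUniformlyOn {Ω : ℕ → Type*} [∀ n, MeasurableSpace (Ω n)]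
    (P : (n : ℕ) → Measure (Ω n)) {T E : Type*} [PseudoMetricSpace E]
    (G : (n : ℕ) → T → Ω n → E) (h : T → E) (N : Set T) : Prop :=
  ∀ ε : ℝ, 0 < ε →
    Tendsto (fun n => P n {x | ∃ θ ∈ N, ε ≤ dist (G n θ x) (h θ)}) atTop (𝓝 0)

/-! The score vanishes at the maximum likelihood estimator, an interior maximum of the likelihood.
Near `θstar` the normalized information is uniformly close to `A θstar`, so the mean value
inequality between `θstarn n` and `θhat n` turns this into `A z ≈ w`, where `z` is the scaled error
of the estimator, `w` the scaled score at `θstarn n`, and the discrepancy is at most a small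
multiple of `‖z‖`. Invertibility gives `z ≈ A⁻¹ w` up to a small multiple of `‖w‖`
(`tendsto_measure_linearization_error`). As `w` converges in law it is tight, the discrepancy tends
to zero in probability, and Slutsky's theorem gives `z` the limit law of `A⁻¹ w`. The covariance of
that law is `A⁻¹ Sig (A⁻¹)ᵀ`. The transpose disappears because `A θstar` inherits symmetry from the
Hessians (`limit_obsInfo_symm`). -/

section Probability

/-! ### Convergence in probability and in law along varying probability spaces -/

variable {Ω : ℕ → Type*} [mΩ : ∀ n, MeasurableSpace (Ω n)] {P : (n : ℕ) → Measure (Ω n)}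

theorem tendsto_measure_zero_of_subset {s t : (n : ℕ) → Set (Ω n)} (hst : ∀ᶠ n in atTop, s n ⊆ t n)
    (ht : Tendsto (fun n => P n (t n)) atTop (𝓝 0)) :
    Tendsto (fun n => P n (s n)) atTop (𝓝 0) :=
  tendsto_of_tendsto_of_tendsto_of_le_of_le' tendsto_const_nhds ht
    (Eventually.of_forall fun _ => zero_le) (hst.mono fun _ h => measure_mono h)

theorem tendsto_measure_union_zero {s t : (n : ℕ) → Set (Ω n)}
    (hs : Tendsto (fun n => P n (s n)) atTop (𝓝 0))
    (ht : Tendsto (fun n => P n (t n)) atTop (𝓝 0)) :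
    Tendsto (fun n => P n (s n ∪ t n)) atTop (𝓝 0) :=
  tendsto_of_tendsto_of_tendsto_of_le_of_le tendsto_const_nhds (by simpa using hs.add ht)
    (fun _ => zero_le) fun _ => measure_union_le _ _

theorem tendsto_measure_iUnion_zero {κ : Type*} [Fintype κ] {s : κ → (n : ℕ) → Set (Ω n)}
    (hs : ∀ k, Tendsto (fun n => P n (s k n)) atTop (𝓝 0)) :
    Tendsto (fun n => P n (⋃ k, s k n)) atTop (𝓝 0) :=
  tendsto_of_tendsto_of_tendsto_of_le_of_le tendsto_const_nhds
    (by simpa using tendsto_finsetSum Finset.univ fun k _ => hs k)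
    (fun _ => zero_le) fun _ => measure_iUnion_fintype_le _ _

theorem tendsto_measure_not_of_ae {p : (n : ℕ) → Ω n → Prop} (h : ∀ n, ∀ᵐ x ∂(P n), p n x) :
    Tendsto (fun n => P n {x | ¬ p n x}) atTop (𝓝 0) := by
  have : (fun n => P n {x | ¬ p n x}) = fun _ => 0 := funext fun n => h n
  rw [this]
  exact tendsto_const_nhds

variable [hP : ∀ n, IsProbabilityMeasure (P n)]

/-- Deterministic facts about limits in probability follow by exhibiting a single good observation.
-/
theorem exists_notMem_of_tendsto_measure_zero {s : (n : ℕ) → Set (Ω n)}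
    (hs : Tendsto (fun n => P n (s n)) atTop (𝓝 0)) : ∃ n x, x ∉ s n := by
  obtain ⟨n, hn⟩ := (hs.eventually_lt_const zero_lt_one).exists
  refine ⟨n, ?_⟩
  by_contra! h
  rw [Set.eq_univ_of_forall h, measure_univ] at hn
  exact lt_irrefl _ hn

variable {E Ω' : Type*} {m' : MeasurableSpace Ω'} {μ' : Measure Ω'} [IsProbabilityMeasure μ']
  [NormedAddCommGroup E] [MeasurableSpace E] [BorelSpace E] [SecondCountableTopology E]

omit [SecondCountableTopology E] in
/-- Random variables with values in a common space, each on a probability space of its own, are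
realized on the product space with the same laws. -/
theorem tendstoInDistribution_comp_eval_iff {X : (n : ℕ) → Ω n → E} {Z : Ω' → E}
    (hX : ∀ n, AEMeasurable (X n) (P n)) :
    TendstoInDistribution (fun n (x : ∀ k, Ω k) => X n (x n)) atTop Z
      (fun _ => Measure.infinitePi P) μ' ↔ TendstoInDistribution X atTop Z P μ' := by
  have hmp n := measurePreserving_eval_infinitePi P n
  have hX' n : AEMeasurable (fun x : ∀ k, Ω k => X n (x n)) (Measure.infinitePi P) :=
    (hX n).comp_quasiMeasurePreserving (hmp n).quasiMeasurePreserving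
  have hmap n : (Measure.infinitePi P).map (fun x : ∀ k, Ω k => X n (x n)) = (P n).map (X n) := by
    have := AEMeasurable.map_map_of_aemeasurable (f := Function.eval n)
      ((hmp n).map_eq.symm ▸ hX n) (hmp n).measurable.aemeasurable
    rw [(hmp n).map_eq] at this
    exact this.symm
  constructor
  · rintro ⟨_, h2, h3⟩
    refine ⟨hX, h2, ?_⟩
    exact h3.congr fun n => Subtype.ext (hmap n)
  · rintro ⟨_, h2, h3⟩
    refine ⟨hX', h2, ?_⟩
    exact h3.congr fun n => Subtype.ext (hmap n).symm

omit [SecondCountableTopology E] in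
theorem MeasureTheory.TendstoInDistribution.of_map_eq {Ω'' : Type*} {m'' : MeasurableSpace Ω''}
    {μ'' : Measure Ω''} [IsProbabilityMeasure μ''] {X : (n : ℕ) → Ω n → E} {Z : Ω' → E}
    {Z' : Ω'' → E} (hX : TendstoInDistribution X atTop Z P μ') (hZ' : AEMeasurable Z' μ'')
    (h : μ'.map Z = μ''.map Z') : TendstoInDistribution X atTop Z' P μ'' := by
  obtain ⟨h1, h2, h3⟩ := hX
  refine ⟨h1, hZ', ?_⟩
  convert! h3 using 3
  exact congrArg 𝓝 (Subtype.ext h.symm)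

/-- Slutsky's theorem, carried over from a common probability space by realizing all observations on
the product space. -/
theorem MeasureTheory.TendstoInDistribution.of_tendstoInProb_sub {X Y : (n : ℕ) → Ω n → E} {Z : Ω' → E}
    (hX : TendstoInDistribution X atTop Z P μ') (hY : ∀ n, AEMeasurable (Y n) (P n))
    (h : TendstoInProb P (fun n x => Y n x - X n x) 0) :
    TendstoInDistribution Y atTop Z P μ' := by
  have hXm := hX.forall_aemeasurable
  rw [← tendstoInDistribution_comp_eval_iff hXm] at hX
  rw [← tendstoInDistribution_comp_eval_iff hY]
  refine tendstoInDistribution_of_tendstoInMeasure_sub _ _ hX ?_ fun n =>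
    (hY n).comp_quasiMeasurePreserving
      (measurePreserving_eval_infinitePi P n).quasiMeasurePreserving
  rw [tendstoInMeasure_iff_norm]
  intro ε hε
  convert! h ε hε using 2 with n
  rw [← (measurePreserving_eval_infinitePi P n).measure_preimage
    (nullMeasurableSet_le aemeasurable_const (by have := hXm n; have := hY n; fun_prop))]
  congr 1
  ext x
  simp

/-- Tightness: the limit law is tight, and the portmanteau inequality passes its tail bound to large
`n`. -/
theorem MeasureTheory.TendstoInDistribution.exists_eventually_measure_norm_ge_le [ProperSpace E]
    {X : (n : ℕ) → Ω n → E} {Z : Ω' → E} (hX : TendstoInDistribution X atTop Z P μ')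
    {δ : ENNReal} (hδ : 0 < δ) :
    ∃ R : ℝ, 0 < R ∧ ∀ᶠ n in atTop, P n {x | R ≤ ‖X n x‖} ≤ δ := by
  have hprob := Measure.isProbabilityMeasure_map (hX.aemeasurable_limit)
  have ht : IsTightMeasureSet {μ'.map Z} := isTightMeasureSet_singleton
  have h := tendsto_measure_compl_closedBall_of_isTightMeasureSet ht 0
  simp only [Set.mem_singleton_iff, iSup_iSup_eq_left] at h
  obtain ⟨r, hr, hr0⟩ := ((h.eventually_lt_const hδ).and (eventually_gt_atTop 0)).exists
  -- The portmanteau inequality needs a closed set; `r + 1 ≤ ‖x‖` defines one inside the complement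
  -- of the closed ball of radius `r`.
  refine ⟨r + 1, by linarith, ?_⟩
  have hclosed : IsClosed {x : E | r + 1 ≤ ‖x‖} := isClosed_le continuous_const continuous_norm
  have hlim := ProbabilityMeasure.limsup_measure_closed_le_of_tendsto hX.tendsto hclosed
  have hlt : (μ'.map Z) {x : E | r + 1 ≤ ‖x‖} < δ := by
    refine lt_of_le_of_lt (measure_mono fun x hx => ?_) hr
    simp only [Set.mem_ofPred_eq] at hx
    simp only [Set.mem_compl_iff, Metric.mem_closedBall, dist_zero_right, not_le]
    linarith
  filter_upwards [eventually_lt_of_limsup_lt (lt_of_le_of_lt hlim hlt)] with n hn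
  have := hn.le
  simp only [ProbabilityMeasure.coe_mk] at this
  rwa [Measure.map_apply_of_aemeasurable (hX.forall_aemeasurable n) hclosed.measurableSet] at this

/-- A sequence that is negligible in comparison with a sequence converging in distribution tends
to zero in probability. -/
theorem MeasureTheory.TendstoInDistribution.tendstoInProb_zero_of_norm_le_mul [ProperSpace E]
    {X D : (n : ℕ) → Ω n → E} {Z : Ω' → E} (hX : TendstoInDistribution X atTop Z P μ')
    (h : ∀ ε : ℝ, 0 < ε → Tendsto (fun n => P n {x | ¬ ‖D n x‖ ≤ ε * ‖X n x‖}) atTop (𝓝 0)) :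
    TendstoInProb P D 0 := by
  intro η hη
  rw [ENNReal.tendsto_nhds_zero]
  intro δ hδ
  have hδ2 : 0 < δ / 2 := ENNReal.half_pos hδ.ne'
  obtain ⟨R, hR, hR'⟩ := hX.exists_eventually_measure_norm_ge_le hδ2
  -- With this ratio, `‖X n x‖ < R` forces `‖D n x‖ ≤ η / 2 < η`.
  have h1 := (ENNReal.tendsto_nhds_zero.1 (h (η / (2 * R)) (by positivity))) _ hδ2
  filter_upwards [hR', h1] with n hn1 hn2
  calc P n {x | η ≤ dist (D n x) 0}
      ≤ P n ({x | ¬ ‖D n x‖ ≤ η / (2 * R) * ‖X n x‖} ∪ {x | R ≤ ‖X n x‖}) := by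
        refine measure_mono fun x hx => ?_
        by_contra hcon
        simp only [Set.mem_union, Set.mem_ofPred_eq, not_or, not_le] at hcon
        simp only [Set.mem_ofPred_eq, dist_zero_right] at hx
        have : η / (2 * R) * ‖X n x‖ ≤ η / (2 * R) * R := by gcongr; exact hcon.2.le
        have h3 : η / (2 * R) * R = η / 2 := by field_simp
        linarith [hcon.1]
    _ ≤ δ / 2 + δ / 2 := (measure_union_le _ _).trans (add_le_add hn2 hn1)
    _ = δ := ENNReal.add_halves δ

end Probability

/-! ### Gaussian images, covariance matrices and operator norms -/

section Matrices

variable {ι : Type*} [Fintype ι] [DecidableEq ι]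

/-- A Gaussian law is determined by its mean and covariance; both sides are centred with the same
covariance form. -/
theorem map_multivariateGaussian_zero {S : Matrix ι ι ℝ} (hS : S.PosSemidef)
    (B : Matrix ι ι ℝ) :
    (multivariateGaussian 0 S).map (Matrix.toEuclideanCLM (𝕜 := ℝ) B) =
      multivariateGaussian 0 (B * S * B.conjTranspose) := by
  have hL : IsGaussian ((multivariateGaussian 0 S).map (Matrix.toEuclideanCLM (𝕜 := ℝ) B)) :=
    inferInstance
  refine IsGaussian.ext ?_ ?_
  · simp only [id, integral_id_multivariateGaussian]
    rw [integral_map (by fun_prop) (by fun_prop),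
      ContinuousLinearMap.integral_comp_comm _ IsGaussian.integrable_fun_id]
    simp
  · ext x y
    rw [covarianceBilin_map IsGaussian.memLp_two_id,
      covarianceBilin_multivariateGaussian (hS.mul_mul_conjTranspose_same B),
      covarianceBilin_multivariateGaussian hS]
    have hadj : (Matrix.toEuclideanCLM (𝕜 := ℝ) B).adjoint =
        Matrix.toEuclideanCLM (𝕜 := ℝ) B.conjTranspose := by
      rw [← ContinuousLinearMap.star_eq_adjoint, ← map_star]; rfl
    rw [hadj]
    simp [Matrix.ofLp_toEuclideanCLM, Matrix.dotProduct_mulVec, Matrix.vecMul_mulVec,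
      Matrix.mul_assoc]

-- The quadratic form at `v` is the variance of `∑ i, v i * X i`.
omit [DecidableEq ι] in
theorem posSemidef_covariance {Ω : Type*} [MeasurableSpace Ω] {μ : Measure Ω}
    [IsFiniteMeasure μ] {X : ι → Ω → ℝ} (hX : ∀ i, MemLp (X i) 2 μ) :
    (Matrix.of fun i j => covariance (X i) (X j) μ).PosSemidef := by
  refine Matrix.PosSemidef.of_dotProduct_mulVec_nonneg ?_ fun v => ?_
  · ext i j
    simp [covariance_comm]
  · have h : star v ⬝ᵥ (Matrix.of fun i j => covariance (X i) (X j) μ).mulVec v =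
        covariance (fun ω => ∑ i, v i * X i ω) (fun ω => ∑ i, v i * X i ω) μ := by
      rw [covariance_fun_sum_fun_sum (fun i => (hX i).const_mul (v i))
        (fun i => (hX i).const_mul (v i))]
      simp only [dotProduct, Matrix.mulVec, Matrix.of_apply, covariance_const_mul_left,
        covariance_const_mul_right, Finset.mul_sum, Pi.star_apply, star_trivial]
      refine Finset.sum_congr rfl fun i _ => Finset.sum_congr rfl fun j _ => by ring
    rw [h]
    rw [covariance_self]
    · exact variance_nonneg _ _
    · exact (memLp_finsetSum Finset.univ fun i _ => (hX i).const_mul (v i)).aestronglyMeasurable.aemeasurable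

omit [DecidableEq ι] in
theorem Matrix.PosSemidef.of_tendsto {κ : Type*} {l : Filter κ} [l.NeBot]
    {S : κ → Matrix ι ι ℝ} {T : Matrix ι ι ℝ} (hS : ∀ k, (S k).PosSemidef)
    (h : Tendsto S l (𝓝 T)) : T.PosSemidef := by
  refine Matrix.PosSemidef.of_dotProduct_mulVec_nonneg ?_ fun v => ?_
  · have hc : Continuous fun M : Matrix ι ι ℝ => M.conjTranspose := by fun_prop
    refine tendsto_nhds_unique ((hc.tendsto T).comp h) (h.congr fun k => ?_)
    exact (hS k).isHermitian.eq.symm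
  · have hc : Continuous fun M : Matrix ι ι ℝ => star v ⬝ᵥ M.mulVec v := by fun_prop
    exact ge_of_tendsto' ((hc.tendsto T).comp h) fun k => (hS k).dotProduct_mulVec_nonneg v

theorem EuclideanSpace.opNorm_le_of_entry_le (T : EuclideanSpace ℝ ι →L[ℝ] EuclideanSpace ℝ ι)
    {ε : ℝ} (hε : 0 ≤ ε) (h : ∀ i j, |T (EuclideanSpace.single j 1) i| ≤ ε) :
    ‖T‖ ≤ Fintype.card ι * (Fintype.card ι * ε) := by
  have hnorm (y : EuclideanSpace ℝ ι) {c : ℝ} (hy : ∀ i, |y i| ≤ c) :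
      ‖y‖ ≤ Fintype.card ι * c := by
    calc ‖y‖ = ‖∑ i, y i • EuclideanSpace.basisFun ι ℝ i‖ := by
          congr 1
          simpa using ((EuclideanSpace.basisFun ι ℝ).sum_repr y).symm
      _ ≤ ∑ i, |y i| := (norm_sum_le _ _).trans_eq (by simp [norm_smul])
      _ ≤ ∑ _i : ι, c := Finset.sum_le_sum fun i _ => hy i
      _ = Fintype.card ι * c := by simp
  refine T.opNorm_le_bound (by positivity) fun y => ?_
  calc ‖T y‖ = ‖∑ j, y j • T (EuclideanSpace.single j 1)‖ := by
        conv_lhs => rw [← (EuclideanSpace.basisFun ι ℝ).sum_repr y]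
        simp
    _ ≤ ∑ j, |y j| * ‖T (EuclideanSpace.single j 1)‖ :=
        (norm_sum_le _ _).trans_eq (by simp [norm_smul])
    _ ≤ ∑ _j : ι, ‖y‖ * (Fintype.card ι * ε) := by
        refine Finset.sum_le_sum fun j _ => ?_
        gcongr
        · exact PiLp.norm_apply_le y j
        · exact hnorm _ fun i => h i j
    _ = Fintype.card ι * (Fintype.card ι * ε) * ‖y‖ := by simp; ring

end Matrices

/-! ### Gradient and second derivative -/

section Calculus

variable {ι : Type*} [Fintype ι] [DecidableEq ι] {l : EuclideanSpace ℝ ι → ℝ}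
  {s : Set (EuclideanSpace ℝ ι)}

omit [DecidableEq ι] in
theorem ContDiffOn.gradient_of_isOpen (hl : ContDiffOn ℝ 2 l s) (hs : IsOpen s) :
    ContDiffOn ℝ 1 (gradient l) s :=
  (InnerProductSpace.toDual ℝ (EuclideanSpace ℝ ι)).symm.contDiff.comp_contDiffOn
    (hl.fderiv_of_isOpen hs (by norm_num))

theorem fderiv_gradient_apply (hl : ContDiffOn ℝ 2 l s) (hs : IsOpen s)
    {θ : EuclideanSpace ℝ ι} (hθ : θ ∈ s) (v : EuclideanSpace ℝ ι) (i : ι) :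
    fderiv ℝ (gradient l) θ v i = fderiv ℝ (fderiv ℝ l) θ v (EuclideanSpace.single i 1) := by
  have hd : DifferentiableAt ℝ (fderiv ℝ l) θ :=
    ((hl.fderiv_of_isOpen hs (by norm_num : (1 : WithTop ℕ∞) + 1 ≤ 2)).contDiffAt
      (hs.mem_nhds hθ)).differentiableAt one_ne_zero
  have h := ((InnerProductSpace.toDual ℝ
    (EuclideanSpace ℝ ι)).symm.toContinuousLinearEquiv.hasFDerivAt.comp θ hd.hasFDerivAt).fderiv
  have h' : fderiv ℝ (gradient l) θ v =
      (InnerProductSpace.toDual ℝ (EuclideanSpace ℝ ι)).symm (fderiv ℝ (fderiv ℝ l) θ v) :=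
    congrArg (fun T => T v) h
  rw [h', ← InnerProductSpace.toDual_symm_apply (𝕜 := ℝ), real_inner_comm,
    EuclideanSpace.inner_single_left, map_one, one_mul]

end Calculus

/-! ### Score and information at a fixed observation -/

namespace ModelClasses

variable {M : ℕ} {S : ModelClasses M} {m : Fin M} {n : ℕ} {x : S.𝒳 n} {θ : S.Param m}

theorem continuousAt_obsInfo (h : ContDiffOn ℝ 2 (S.logLik m n x) (S.Θ m)) (hθ : θ ∈ S.Θ m)
    (i j : Fin (S.g m)) : ContinuousAt (fun θ => S.obsInfo m n θ x i j) θ := by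
  have h1 : ContinuousOn (fderiv ℝ (gradient (S.logLik m n x))) (S.Θ m) :=
    (h.gradient_of_isOpen (S.isOpen_Θ m)).continuousOn_fderiv_of_isOpen (S.isOpen_Θ m) le_rfl
  have h2 : ContinuousAt (fderiv ℝ (gradient (S.logLik m n x))) θ :=
    h1.continuousAt ((S.isOpen_Θ m).mem_nhds hθ)
  have h3 : Continuous fun T : S.Param m →L[ℝ] S.Param m =>
      -(T (EuclideanSpace.single j 1)) i := by fun_prop
  exact h3.continuousAt.comp h2

theorem obsInfo_symm (h : ContDiffOn ℝ 2 (S.logLik m n x) (S.Θ m)) (hθ : θ ∈ S.Θ m)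
    (i j : Fin (S.g m)) : S.obsInfo m n θ x i j = S.obsInfo m n θ x j i := by
  have hsymm : IsSymmSndFDerivAt ℝ (S.logLik m n x) θ :=
    (h.contDiffAt ((S.isOpen_Θ m).mem_nhds hθ)).isSymmSndFDerivAt (by simp)
  have key (i j : Fin (S.g m)) : S.obsInfo m n θ x i j =
      -fderiv ℝ (fderiv ℝ (S.logLik m n x)) θ (EuclideanSpace.single j 1)
        (EuclideanSpace.single i 1) :=
    congrArg Neg.neg (fderiv_gradient_apply h (S.isOpen_Θ m) hθ (EuclideanSpace.single j 1) i)
  rw [key, key, hsymm.eq]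

theorem IsMLE.score_eq_zero (hmle : S.IsMLE m n x θ) (hpos : ∀ θ ∈ S.Θ m, 0 < S.f m n θ x) :
    S.score m n θ x = 0 := by
  have hmax : IsLocalMax (S.logLik m n x) θ := by
    filter_upwards [(S.isOpen_Θ m).mem_nhds hmle.1] with η hη
    exact Real.log_le_log (hpos η hη) (hmle.2 hη)
  simp [score, gradient, hmax.fderiv_eq_zero]

/-- If the normalized information is uniformly close to `A`, the normalized score is nearly affine
with slope `-A`. -/
theorem norm_score_sub_add_le (h : ContDiffOn ℝ 2 (S.logLik m n x) (S.Θ m))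
    {s : Set (S.Param m)} (hs : Convex ℝ s) (hsΘ : s ⊆ S.Θ m)
    {A : Matrix (Fin (S.g m)) (Fin (S.g m)) ℝ} {ε : ℝ} (hε : 0 ≤ ε)
    (hA : ∀ θ ∈ s, ∀ i j, |(n : ℝ)⁻¹ * S.obsInfo m n θ x i j - A i j| ≤ ε)
    {a b : S.Param m} (ha : a ∈ s) (hb : b ∈ s) :
    ‖(n : ℝ)⁻¹ • S.score m n b x - (n : ℝ)⁻¹ • S.score m n a x +
      Matrix.toEuclideanCLM (𝕜 := ℝ) A (b - a)‖ ≤ S.g m * (S.g m * ε) * ‖b - a‖ := by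
  have hd (θ : S.Param m) (hθ : θ ∈ s) :
      DifferentiableAt ℝ (fun η => S.score m n η x) θ :=
    ((h.gradient_of_isOpen (S.isOpen_Θ m)).contDiffAt
      ((S.isOpen_Θ m).mem_nhds (hsΘ hθ))).differentiableAt one_ne_zero
  have hmv := hs.norm_image_sub_le_of_norm_hasFDerivWithin_le'
    (f := fun η => (n : ℝ)⁻¹ • S.score m n η x)
    (f' := fun θ => (n : ℝ)⁻¹ • fderiv ℝ (fun η => S.score m n η x) θ)
    (φ := -Matrix.toEuclideanCLM (𝕜 := ℝ) A) (C := S.g m * (S.g m * ε))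
    (fun θ hθ => ((hd θ hθ).hasFDerivAt.fun_const_smul _).hasFDerivWithinAt) (fun θ hθ => ?_) ha hb
  · rwa [_root_.neg_apply, sub_neg_eq_add] at hmv
  · have hT := EuclideanSpace.opNorm_le_of_entry_le
      ((n : ℝ)⁻¹ • fderiv ℝ (fun η => S.score m n η x) θ - -Matrix.toEuclideanCLM (𝕜 := ℝ) A)
      hε fun i j => ?_
    · simpa using hT
    · refine le_of_eq_of_le ?_ (hA θ hθ i j)
      rw [← abs_neg]
      congr 1
      simp [obsInfo, Matrix.ofLp_toEuclideanCLM]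
      ring

end ModelClasses

/-! ### Symmetry and continuity of the limiting information -/

namespace ModelClasses

variable {M : ℕ} {S : ModelClasses M} {m m' : Fin M} {θ' : S.Θ m'}
  {A : S.Param m → Matrix (Fin (S.g m)) (Fin (S.g m)) ℝ}
  {N : Set (S.Param m)} {θ : S.Param m}

/-- For some sample size and some observation, the log-likelihood is smooth and the normalized
information is uniformly close to its limit. -/
theorem exists_smooth_abs_obsInfo_sub_lt
    (h_smooth : ∀ n, ∀ᵐ x ∂(S.law m' n θ'), ContDiffOn ℝ 2 (S.logLik m n x) (S.Θ m))
    (h_A : ∀ i j, TendstoInProbUniformlyOn (fun n => S.law m' n θ')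
      (fun n θ x => (n : ℝ)⁻¹ * S.obsInfo m n θ x i j) (fun θ => A θ i j) N)
    {ε : ℝ} (hε : 0 < ε) :
    ∃ n x, ContDiffOn ℝ 2 (S.logLik m n x) (S.Θ m) ∧
      ∀ θ ∈ N, ∀ i j, |(n : ℝ)⁻¹ * S.obsInfo m n θ x i j - A θ i j| < ε := by
  obtain ⟨n, x, hx⟩ := exists_notMem_of_tendsto_measure_zero
    (tendsto_measure_union_zero (tendsto_measure_not_of_ae h_smooth)
      (tendsto_measure_iUnion_zero fun i => tendsto_measure_iUnion_zero fun j => h_A i j ε hε))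
  simp only [Set.mem_union, Set.mem_ofPred_eq, Set.mem_iUnion, not_or, not_not, not_exists,
    not_and, not_le, Real.dist_eq] at hx
  exact ⟨n, x, hx.1, fun θ hθ i j => hx.2 i j θ hθ⟩

theorem limit_obsInfo_symm
    (h_smooth : ∀ n, ∀ᵐ x ∂(S.law m' n θ'), ContDiffOn ℝ 2 (S.logLik m n x) (S.Θ m))
    (h_A : ∀ i j, TendstoInProbUniformlyOn (fun n => S.law m' n θ')
      (fun n θ x => (n : ℝ)⁻¹ * S.obsInfo m n θ x i j) (fun θ => A θ i j) N)
    (hθ : θ ∈ S.Θ m) (hθN : θ ∈ N) : (A θ).transpose = A θ := by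
  ext i j
  refine eq_of_abs_sub_le_all fun ε hε => ?_
  obtain ⟨n, x, hx, h⟩ := exists_smooth_abs_obsInfo_sub_lt h_smooth h_A (half_pos hε)
  have h1 := abs_lt.1 (h θ hθN i j)
  have h2 := abs_lt.1 (h θ hθN j i)
  rw [obsInfo_symm hx hθ j i] at h2
  rw [Matrix.transpose_apply, abs_le]
  constructor <;> linarith

/-- An `ε / 3` argument: on `N` the limit is uniformly approximated by the information of one good
observation, which is continuous at `θ`. -/
theorem continuousAt_limit_obsInfo
    (h_smooth : ∀ n, ∀ᵐ x ∂(S.law m' n θ'), ContDiffOn ℝ 2 (S.logLik m n x) (S.Θ m))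
    (h_A : ∀ i j, TendstoInProbUniformlyOn (fun n => S.law m' n θ')
      (fun n θ x => (n : ℝ)⁻¹ * S.obsInfo m n θ x i j) (fun θ => A θ i j) N)
    (hθ : θ ∈ S.Θ m) (hN : N ∈ 𝓝 θ) (i j : Fin (S.g m)) :
    ContinuousAt (fun θ => A θ i j) θ := by
  refine Metric.tendsto_nhds.2 fun ε hε => ?_
  obtain ⟨n, x, hx, h⟩ := exists_smooth_abs_obsInfo_sub_lt h_smooth h_A
    (by positivity : 0 < ε / 3)
  have hc := ((continuousAt_obsInfo hx hθ i j).const_mul (n : ℝ)⁻¹)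
  filter_upwards [Metric.tendsto_nhds.1 hc (ε / 3) (by positivity), hN] with η h1 h2
  rw [Real.dist_eq] at h1 ⊢
  have h3 := abs_lt.1 h1
  have h4 := abs_lt.1 (h η h2 i j)
  have h5 := abs_lt.1 (h θ (mem_of_mem_nhds hN) i j)
  rw [abs_lt]
  constructor <;> linarith

end ModelClasses

/-! ### Linearization of the score equation -/

/-- An equation `A z ≈ w` with small relative error in `z` is solved by `z ≈ A⁻¹ w` with small
relative error in `w`. -/
theorem exists_norm_sub_le_of_norm_map_sub_le {E : Type*} [NormedAddCommGroup E] [NormedSpace ℝ E]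
    {A B : E →L[ℝ] E} (hBA : ∀ z, B (A z) = z) {ε : ℝ} (hε : 0 < ε) :
    ∃ η : ℝ, 0 < η ∧ ∀ z w : E, ‖A z - w‖ ≤ η * ‖z‖ → ‖z - B w‖ ≤ ε * ‖w‖ := by
  set c := ‖B‖ + 1 with hc
  have hc0 : 0 < c := by positivity
  have hBc (v : E) : ‖B v‖ ≤ c * ‖v‖ := (B.le_opNorm v).trans (by gcongr; linarith)
  -- The first bound absorbs half of `‖z‖` and yields `‖z‖ ≤ 2 * c * ‖w‖`; the second then makes the
  -- error at most `ε * ‖w‖`.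
  refine ⟨min (1 / (2 * c)) (ε / (2 * c ^ 2)), by positivity, fun z w h => ?_⟩
  have h1 : ‖z - B w‖ ≤ c * ‖A z - w‖ := by simpa [hBA] using hBc (A z - w)
  have h2 : ‖A z - w‖ ≤ 1 / (2 * c) * ‖z‖ := h.trans (by gcongr; exact min_le_left _ _)
  have h3 : ‖A z - w‖ ≤ ε / (2 * c ^ 2) * ‖z‖ := h.trans (by gcongr; exact min_le_right _ _)
  have h4 : ‖z‖ ≤ ‖z - B w‖ + ‖B w‖ := by simpa using norm_add_le (z - B w) (B w)
  have h5 : c * ‖A z - w‖ ≤ ‖z‖ / 2 := by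
    calc c * ‖A z - w‖ ≤ c * (1 / (2 * c) * ‖z‖) := by gcongr
      _ = ‖z‖ / 2 := by field_simp
  have h6 : ‖z‖ ≤ 2 * c * ‖w‖ := by linarith [hBc w]
  calc ‖z - B w‖ ≤ c * (ε / (2 * c ^ 2) * (2 * c * ‖w‖)) :=
        h1.trans (by gcongr; exact h3.trans (by gcongr))
    _ = ε * ‖w‖ := by field_simp

namespace ModelClasses

variable {M : ℕ} {S : ModelClasses M} {m m' : Fin M} {θ' : S.Θ m'}

/-- The linearization of the score equation: with probability tending to one, the scaled error of
the maximum likelihood estimator is close to `A⁻¹` times the scaled score. -/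
theorem tendsto_measure_linearization_error
    (h_pos : ∀ n, ∀ᵐ x ∂(S.law m' n θ'), ∀ θ ∈ S.Θ m, 0 < S.f m n θ x)
    (h_smooth : ∀ n, ∀ᵐ x ∂(S.law m' n θ'), ContDiffOn ℝ 2 (S.logLik m n x) (S.Θ m))
    {θstarn : ℕ → S.Param m} {θstar : S.Param m} (h_star : θstar ∈ S.Θ m)
    (h_lim : Tendsto θstarn atTop (𝓝 θstar))
    {A : S.Param m → Matrix (Fin (S.g m)) (Fin (S.g m)) ℝ}
    {N : Set (S.Param m)} (h_N : N ∈ 𝓝 θstar)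
    (h_A : ∀ i j, TendstoInProbUniformlyOn (fun n => S.law m' n θ')
      (fun n θ x => (n : ℝ)⁻¹ * S.obsInfo m n θ x i j) (fun θ => A θ i j) N)
    (h_inv : IsUnit (A θstar)) {θhat : (n : ℕ) → S.𝒳 n → S.Param m}
    (h_mle : Tendsto (fun n => S.law m' n θ' {x | ¬ S.IsMLE m n x (θhat n x)}) atTop (𝓝 0))
    (h_cons : TendstoInProb (fun n => S.law m' n θ') θhat θstar) {ε : ℝ} (hε : 0 < ε) :
    Tendsto (fun n => S.law m' n θ' {x |
      ¬ ‖√(n : ℝ) • (θhat n x - θstarn n) - Matrix.toEuclideanCLM (𝕜 := ℝ) (A θstar)⁻¹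
          ((√(n : ℝ))⁻¹ • S.score m n (θstarn n) x)‖ ≤
        ε * ‖(√(n : ℝ))⁻¹ • S.score m n (θstarn n) x‖}) atTop (𝓝 0) := by
  have hdet : IsUnit (A θstar).det := (Matrix.isUnit_iff_isUnit_det _).1 h_inv
  obtain ⟨η, hη, hηle⟩ := exists_norm_sub_le_of_norm_map_sub_le
    (A := Matrix.toEuclideanCLM (𝕜 := ℝ) (A θstar))
    (B := Matrix.toEuclideanCLM (𝕜 := ℝ) (A θstar)⁻¹) (fun z => by
      rw [← mul_apply_eq_comp, ← map_mul, Matrix.nonsing_inv_mul _ hdet, map_one,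
        one_apply_eq_self]) hε
  have hg : (0 : ℝ) < S.g m := Nat.cast_pos.2 (S.g_pos m)
  -- One `δ` bounds the deviation of the information from `A θ`, the other that of `A θ` from `A
  -- θstar`; the factor `g²` passes from entries to the operator norm.
  obtain ⟨δ, hδ, hδη⟩ : ∃ δ : ℝ, 0 < δ ∧ S.g m * (S.g m * (δ + δ)) = η :=
    ⟨η / (2 * S.g m ^ 2), by positivity, by field_simp; ring⟩
  have hnear : ∀ᶠ θ in 𝓝 θstar, θ ∈ S.Θ m ∧ θ ∈ N ∧
      ∀ i j, dist (A θ i j) (A θstar i j) < δ := by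
    refine Filter.Eventually.and ((S.isOpen_Θ m).mem_nhds h_star) (Filter.Eventually.and h_N ?_)
    exact eventually_all.2 fun i => eventually_all.2 fun j => Metric.tendsto_nhds.1
      (continuousAt_limit_obsInfo h_smooth h_A h_star h_N i j) δ hδ
  obtain ⟨r, hr, hball⟩ := Metric.eventually_nhds_iff_ball.1 hnear
  refine tendsto_measure_zero_of_subset (t := fun n => (({x | ¬ ∀ θ ∈ S.Θ m, 0 < S.f m n θ x} ∪
      {x | ¬ ContDiffOn ℝ 2 (S.logLik m n x) (S.Θ m)}) ∪
      ({x | ¬ S.IsMLE m n x (θhat n x)} ∪ {x | r ≤ dist (θhat n x) θstar})) ∪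
      ⋃ i, ⋃ j, {x | ∃ θ ∈ N, δ ≤ dist ((n : ℝ)⁻¹ * S.obsInfo m n θ x i j) (A θ i j)}) ?_ <|
    tendsto_measure_union_zero (tendsto_measure_union_zero
      (tendsto_measure_union_zero (tendsto_measure_not_of_ae h_pos)
        (tendsto_measure_not_of_ae h_smooth))
      (tendsto_measure_union_zero h_mle (h_cons r hr)))
      (tendsto_measure_iUnion_zero fun i => tendsto_measure_iUnion_zero fun j => h_A i j δ hδ)
  filter_upwards [Metric.tendsto_nhds.1 h_lim r hr] with n hn x hx
  contrapose! hx
  simp only [Set.mem_union, Set.mem_ofPred_eq, Set.mem_iUnion, not_or, not_not, not_exists,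
    not_and, not_le] at hx ⊢
  obtain ⟨⟨⟨hpos, hsm⟩, hmle, hcons⟩, hA⟩ := hx
  refine not_lt.2 (hηle _ _ ?_)
  have hb := norm_score_sub_add_le hsm (convex_ball θstar r) (fun θ hθ => (hball θ hθ).1)
    (A := A θstar) (ε := δ + δ) (by positivity) (fun θ hθ i j => ?_)
    (Metric.mem_ball.2 hn) (Metric.mem_ball.2 hcons)
  · rw [hmle.score_eq_zero hpos, hδη, smul_zero, zero_sub] at hb
    -- Also true at `n = 0`, where both sides are `0`.
    have hs : √(n : ℝ) * (n : ℝ)⁻¹ = (√(n : ℝ))⁻¹ := by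
      rw [← div_eq_mul_inv, Real.sqrt_div_self']
      simp
    calc _ = ‖√(n : ℝ) • (-((n : ℝ)⁻¹ • S.score m n (θstarn n) x) +
          Matrix.toEuclideanCLM (𝕜 := ℝ) (A θstar) (θhat n x - θstarn n))‖ := by
          rw [map_smul, smul_add, smul_neg, smul_smul, hs, neg_add_eq_sub]
      _ ≤ √(n : ℝ) * (η * ‖θhat n x - θstarn n‖) := by
          rw [norm_smul, Real.norm_of_nonneg (Real.sqrt_nonneg _)]
          gcongr
      _ = _ := by
          rw [norm_smul, Real.norm_of_nonneg (Real.sqrt_nonneg _)]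
          ring
  · rw [← Real.dist_eq]
    exact (dist_triangle _ (A θ i j) _).trans
      (add_le_add (hA i j θ (hball θ hθ).2.1).le ((hball θ hθ).2.2 i j).le)

theorem posSemidef_scoreCov {n : ℕ} {θ : S.Param m}
    (h : MemLp (S.score m n θ) 2 (S.law m' n θ')) : (S.scoreCov m m' n θ θ').PosSemidef :=
  posSemidef_covariance fun i => h.eval_piLp i

end ModelClasses

/-! ### Asymptotic normality -/

theorem mainTheorem2 {M : ℕ} (S : ModelClasses M) (m m' : Fin M)
    -- the true parameter, in the true class `m'`
    (θ' : S.Θ m')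
    -- the densities of class `m` are positive and smooth in the parameter, almost surely
    (h_pos : ∀ n, ∀ᵐ x ∂(S.law m' n θ'), ∀ θ ∈ S.Θ m, 0 < S.f m n θ x)
    (h_smooth : ∀ n, ∀ᵐ x ∂(S.law m' n θ'), ContDiffOn ℝ 2 (S.logLik m n x) (S.Θ m))
    -- the Kullback-Leibler divergences and their normalized limit
    (h_int : ∀ n, ∀ θ ∈ S.Θ m, Integrable (S.klIntegrand m m' n θ θ') (S.ν n))
    (K : S.Param m → S.Θ m' → ℝ)
    (h_K : ∀ θ ∈ S.Θ m,
      Tendsto (fun n : ℕ => (n : ℝ)⁻¹ * S.KL m m' n θ θ') atTop (𝓝 (K θ θ')))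
    -- the quasi-true parameters and their limit
    (θstarn : ℕ → S.Param m) (θstar : S.Param m)
    (h_starn : ∀ n, θstarn n ∈ S.Θ m ∧
      IsMaxOn (fun θ => S.KL m m' n θ θ') (S.Θ m) (θstarn n))
    (h_star : θstar ∈ S.Θ m ∧ IsMaxOn (fun θ => K θ θ') (S.Θ m) θstar)
    (h_lim : Tendsto θstarn atTop (𝓝 θstar))
    -- uniform convergence in probability of normalized score and information near `θstar`
    (U : S.Param m → S.Θ m' → S.Param m)
    (A : S.Param m → S.Θ m' → Matrix (Fin (S.g m)) (Fin (S.g m)) ℝ)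
    (N : Set (S.Param m)) (h_N : N ∈ 𝓝 θstar)
    (h_U : TendstoInProbUniformlyOn (fun n => S.law m' n θ')
      (fun n θ x => (n : ℝ)⁻¹ • S.score m n θ x) (fun θ => U θ θ') N)
    (h_A : ∀ i j, TendstoInProbUniformlyOn (fun n => S.law m' n θ')
      (fun n θ x => (n : ℝ)⁻¹ * S.obsInfo m n θ x i j) (fun θ => A θ θ' i j) N)
    (h_inv : IsUnit (A θstar θ'))
    -- the limiting covariance and the asymptotic normality of the score
    (Sig : Matrix (Fin (S.g m)) (Fin (S.g m)) ℝ)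
    (h_L2 : ∀ n, MemLp (S.score m n (θstarn n)) 2 (S.law m' n θ'))
    (h_Sig : Tendsto (fun n : ℕ => (n : ℝ)⁻¹ • S.scoreCov m m' n (θstarn n) θ') atTop (𝓝 Sig))
    (h_clt : TendstoInDistribution
      (fun (n : ℕ) x => (√(n : ℝ))⁻¹ • S.score m n (θstarn n) x) atTop id
      (fun n => S.law m' n θ') (multivariateGaussian 0 Sig))
    -- a consistent sequence of estimators, maximum likelihood with probability tending to one
    (θhat : (n : ℕ) → S.𝒳 n → S.Param m)
    (h_meas : ∀ n, AEMeasurable (θhat n) (S.law m' n θ'))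
    (h_mle : Tendsto (fun n => S.law m' n θ' {x | ¬ S.IsMLE m n x (θhat n x)}) atTop (𝓝 0))
    (h_cons : TendstoInProb (fun n => S.law m' n θ') θhat θstar) :
    ((A θstar θ')⁻¹ * Sig * (A θstar θ')⁻¹).PosSemidef ∧
    TendstoInDistribution
      (fun (n : ℕ) x => √(n : ℝ) • (θhat n x - θstarn n)) atTop id
      (fun n => S.law m' n θ')
      (multivariateGaussian 0 ((A θstar θ')⁻¹ * Sig * (A θstar θ')⁻¹)) := by
  -- Positive semidefiniteness, closed under limits, ensures that `Sig` really is the covariance of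
  -- `multivariateGaussian 0 Sig`.
  have h_pd : Sig.PosSemidef := Matrix.PosSemidef.of_tendsto (fun n =>
    (ModelClasses.posSemidef_scoreCov (h_L2 n)).smul (inv_nonneg.2 (Nat.cast_nonneg n))) h_Sig
  set B := (A θstar θ')⁻¹ with hB
  have h_symm : B.conjTranspose = B := by
    rw [Matrix.conjTranspose_eq_transpose_of_trivial, hB, Matrix.transpose_nonsing_inv,
      ModelClasses.limit_obsInfo_symm h_smooth h_A h_star.1 (mem_of_mem_nhds h_N)]
  have h_psd := h_pd.mul_mul_conjTranspose_same B
  have h_map := map_multivariateGaussian_zero h_pd B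
  rw [h_symm] at h_map h_psd
  refine ⟨h_psd, ?_⟩
  have h_lin := (h_clt.continuous_comp (Matrix.toEuclideanCLM (𝕜 := ℝ) B).continuous).of_map_eq
    (μ'' := multivariateGaussian 0 (B * Sig * B)) (Z' := id) aemeasurable_id
    (by rw [Function.comp_id, Measure.map_id, h_map])
  have h_neg : TendstoInProb (fun n => S.law m' n θ') (fun (n : ℕ) x =>
      √(n : ℝ) • (θhat n x - θstarn n) - Matrix.toEuclideanCLM (𝕜 := ℝ) B
        ((√(n : ℝ))⁻¹ • S.score m n (θstarn n) x)) 0 :=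
    h_clt.tendstoInProb_zero_of_norm_le_mul fun ε hε =>
      ModelClasses.tendsto_measure_linearization_error h_pos h_smooth h_star.1 h_lim h_N h_A h_inv
        h_mle h_cons hε
  have h_aem (n : ℕ) : AEMeasurable (fun x => √(n : ℝ) • (θhat n x - θstarn n))
      (S.law m' n θ') :=
    (measurable_const_smul √(n : ℝ)).comp_aemeasurable ((h_meas n).sub_const (θstarn n))
  exact h_lin.of_tendstoInProb_sub h_aem h_neg
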